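/- Let $S$ be a finite set, $L$ an arbitrary set of action labels, and $\mathcal D(S)$ the set of finitely supported probability distributions on $S$, with pointwise convex combinations. Let $(S,L,\to)$ be a probabilistic automaton with state set $S$, i.e. let $\to\ \subseteq S\times L\times\mathcal D(S)$ be an arbitrary relation. Write $s\xrightarrow{a}_c\xi$ if $\xi=\sum_{i=1}^n p_i\xi_i$ is a finite convex combination of distributions $\xi_i$ with $s\xrightarrow{a}\xi_i$ for all $i$. The belief-state transformer is the labelled transition system on $\mathcal D(S)$ in which $\xi\overset{a}{\mapsto}\zeta$ if and only if there are $n$, states $s_1,\dots,s_n$, weights $p_i\ge 0$ with $\sum_i p_i=1$, and distributions $\xi_1,\dots,\xi_n$ such that $\xi=\sum_i p_i\delta_{s_i}$, $s_i\xrightarrow{a}_c\xi_i$ for all $i$, and $\zeta=\sum_i p_i\xi_i$. For a relation $R\subseteq\mathcal D(S)\times\mathcal D(S)$ let $b(R)$ be the set of pairs $(\zeta_1,\zeta_2)$ such that for every $a\in L$: whenever $\zeta_1\overset{a}{\mapsto}\zeta_1'$ there is $\zeta_2'$ with $\zeta_2\overset{a}{\mapsto}\zeta_2'$ and $(\zeta_1',\zeta_2')\in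 R$, and whenever $\zeta_2\overset{a}{\mapsto}\zeta_2'$ there is $\zeta_1'$ with $\zeta_1\overset{a}{\mapsto}\zeta_1'$ and $(\zeta_1',\zeta_2')\in R$. A bisimulation is a relation $R$ with $R\subseteq b(R)$; write $\zeta_1\sim_d\zeta_2$ (distribution bisimilarity) if some bisimulation contains $(\zeta_1,\zeta_2)$. Let $\mathrm{cgr}(R)$ be the smallest congruence containing $R$, where a congruence is an equivalence relation on $\mathcal D(S)$ that is closed under componentwise convex combinations. A bisimulation up-to $\mathrm{cgr}$ is a relation $R$ with $R\subseteq b(\mathrm{cgr}(R))$. If $\zeta_1,\zeta_2\in\mathcal D(S)$ satisfy $\zeta_1\sim_d\zeta_2$, then there exists a finite relation $R\subseteq\mathcal D(S)\times\mathcal D(S)$ with $(\zeta_1,\zeta_2)\in R$ that is a bisimulation up-to $\mathrm{cgr}$. -/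

import Mathlib

/-- `FDist S` is the set `𝒟 S` of finitely supported probability distributions on `S`; it carries
Mathlib's convex-space structure, given by pointwise convex combinations of distributions. -/
abbrev FDist (S : Type*) : Type _ := Convexity.StdSimplex ℝ S

/-- A probabilistic automaton with set of states `S` and set of action labels `L`:
a transition relation contained in `S × L × 𝒟 S`. -/
structure ProbAut (S L : Type*) where
  /-- `step s a ζ` means `s` has an `a`-labelled transition to the distribution `ζ`. -/
  step : S → L → FDist S → Prop

namespace ProbAut

variable {S L : Type*}

/-- The convex transition relation `s →ᵃ_c ξ`: `ξ = ∑ i, p i • ξs i` is a finite convex combination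
of distributions `ξs i` with `s →ᵃ ξs i`. -/
def convStep (M : ProbAut S L) (s : S) (a : L) (ξ : FDist S) : Prop :=
  ∃ (n : ℕ) (p : Convexity.StdSimplex ℝ (Fin n)) (ξs : Fin n → FDist S),
    (∀ i, M.step s a (ξs i)) ∧ ξ = Convexity.iConvexComb p ξs

/-- The transition relation `ξ ↦ᵃ ζ` of the belief-state transformer:
`ξ = ∑ i, p i • s i` (states being identified with their Dirac distributions), `s i →ᵃ_c ξs i`
and `ζ = ∑ i, p i • ξs i`. -/
def beliefStep (M : ProbAut S L) (ξ : FDist S) (a : L) (ζ : FDist S) : Prop :=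
  ∃ (n : ℕ) (p : Convexity.StdSimplex ℝ (Fin n)) (s : Fin n → S) (ξs : Fin n → FDist S),
    ξ = Convexity.iConvexComb p (fun i => (Convexity.StdSimplex.single (s i) : FDist S)) ∧
    (∀ i, M.convStep (s i) a (ξs i)) ∧
    ζ = Convexity.iConvexComb p ξs

/-- The function `b` on relations over `𝒟 S` whose post-fixed points are the bisimulations of the
belief-state transformer. -/
def bisimFun (M : ProbAut S L) (R : Set (FDist S × FDist S)) : Set (FDist S × FDist S) :=
  {ζ | ∀ a : L,
    (∀ ζ₁', M.beliefStep ζ.1 a ζ₁' → ∃ ζ₂', M.beliefStep ζ.2 a ζ₂' ∧ (ζ₁', ζ₂') ∈ R) ∧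
    (∀ ζ₂', M.beliefStep ζ.2 a ζ₂' → ∃ ζ₁', M.beliefStep ζ.1 a ζ₁' ∧ (ζ₁', ζ₂') ∈ R)}

/-- Bisimulations of the belief-state transformer. -/
def IsBisimulation (M : ProbAut S L) (R : Set (FDist S × FDist S)) : Prop :=
  R ⊆ M.bisimFun R

/-- Distribution bisimilarity `ζ₁ ∼_d ζ₂`. -/
def DistBisimilar (M : ProbAut S L) (ζ₁ ζ₂ : FDist S) : Prop :=
  ∃ R : Set (FDist S × FDist S), M.IsBisimulation R ∧ (ζ₁, ζ₂) ∈ R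

/-- Bisimulations up-to `f`. -/
def IsBisimulationUpTo (M : ProbAut S L)
    (f : Set (FDist S × FDist S) → Set (FDist S × FDist S))
    (R : Set (FDist S × FDist S)) : Prop :=
  R ⊆ M.bisimFun (f R)

end ProbAut

/-- Congruences of the convex algebra `𝒟 S`: equivalence relations closed under componentwise
(binary, hence all finite) convex combinations. -/
structure IsConvexCongruence {S : Type*} (C : Set (FDist S × FDist S)) : Prop where
  equivalence : Equivalence (fun ζ ξ : FDist S => (ζ, ξ) ∈ C)
  convexComb : ∀ (p q : ℝ) (hp : 0 ≤ p) (hq : 0 ≤ q) (hpq : p + q = 1) (ζ₁ ζ₂ ξ₁ ξ₂ : FDist S),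
    (ζ₁, ζ₂) ∈ C → (ξ₁, ξ₂) ∈ C →
    (Convexity.convexCombPair p q hp hq hpq ζ₁ ξ₁,
      Convexity.convexCombPair p q hp hq hpq ζ₂ ξ₂) ∈ C

/-- The congruence closure of `R`: the smallest congruence of `𝒟 S` containing `R`. -/
def cgr {S : Type*} (R : Set (FDist S × FDist S)) : Set (FDist S × FDist S) :=
  ⋂₀ {C | IsConvexCongruence C ∧ R ⊆ C}

/-!
Distribution bisimilarity is itself a congruence, and every congruence of the convex algebra of
distributions on a finite set is finitely generated. Hence a finite generating set of bisimilarity,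
enlarged by the given pair, is a bisimulation up to `cgr`.

Bisimilarity is a congruence (`ProbAut.isConvexCongruence_bisimilarity`) because a step of the
belief-state transformer out of `ξ` amounts to a choice of a convex transition for each state in the
support of `ξ` (`ProbAut.beliefStep_iff_funStep`). With this description, steps of two distributions
combine to a step of their convex combination, and conversely a step of a combination with positive
weights splits into steps of the two summands.

Finite generation (`IsConvexCongruence.exists_finite_generating`) is proved face by face, the faces
of the simplex being indexed by supports. Translating a related pair towards the interior and
composing small translations shows that, on the relative interior of a face, a congruence relates
`x` and `y` exactly if `y - x` lies in a certain subspace (`IsConvexCongruence.directions`), which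
finitely many pairs span. For faces with supports `T ⊆ U`, a single related pair moves every point
of the first into the second, where the previous case applies. Arbitrary related `x` and `y` are
both related to their midpoint, whose support contains both of theirs.
-/

open Convexity

/-! ### Coordinates and convex combinations of distributions -/

section Distributions

variable {S X : Type*}

theorem FDist.weights_iConvexComb_eq_sum [Fintype S] (x : FDist S) (f : S → FDist X) :
    (iConvexComb x f).weights = ∑ s, x.weights s • (f s).weights := by
  rw [(StdSimplex.isAffineMap_weights (R := ℝ) (I := X)).map_iConvexComb, iConvexComb_eq_sum,
    Finsupp.sum_fintype _ _ (by simp)]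
  rfl

/-- Forming `∑ s, x s • f s` is affine in the distribution `x`. -/
theorem FDist.iConvexComb_convexCombPair_left {Y : Type*} [ConvexSpace ℝ Y] {p q : ℝ} (hp : 0 ≤ p)
    (hq : 0 ≤ q) (hpq : p + q = 1) (x y : FDist S) (f : S → Y) :
    iConvexComb (convexCombPair p q hp hq hpq x y) f =
      convexCombPair p q hp hq hpq (iConvexComb x f) (iConvexComb y f) := by
  simp only [iConvexComb]
  rw [(StdSimplex.isAffineMap_map ℝ f).map_convexCombPair, sConvexComb_convexCombPair]

theorem FDist.weights_convexCombPair_apply {p q : ℝ} (hp : 0 ≤ p) (hq : 0 ≤ q) (hpq : p + q = 1)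
    (x y : FDist S) (s : S) :
    (convexCombPair p q hp hq hpq x y).weights s = p * x.weights s + q * y.weights s := by
  simp

/-- Every distribution is the image of a distribution on some `Fin n` along an enumeration of its
support. -/
theorem FDist.exists_fin_map (x : FDist X) :
    ∃ (n : ℕ) (p : StdSimplex ℝ (Fin n)) (f : Fin n → X),
      (∀ i, x.weights (f i) ≠ 0) ∧ x = p.map f := by
  classical
  let e := x.weights.support.equivFin
  let f : Fin x.weights.support.card → X := fun i => (e.symm i : X)
  have hf : Function.Injective f := Subtype.val_injective.comp e.symm.injective
  have hsupp : ∀ s, s ∈ Set.range f ↔ x.weights s ≠ 0 := by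
    intro s
    constructor
    · rintro ⟨i, rfl⟩
      exact Finsupp.mem_support_iff.1 (e.symm i).2
    · intro hs
      exact ⟨e ⟨s, Finsupp.mem_support_iff.2 hs⟩, by simp [f]⟩
  have hmap : (x.weights.comapDomain f hf.injOn).mapDomain f = x.weights :=
    Finsupp.mapDomain_comapDomain f hf x.weights fun s hs =>
      (hsupp s).2 (Finsupp.mem_support_iff.1 hs)
  refine ⟨_, ⟨x.weights.comapDomain f hf.injOn, fun i => x.nonneg _, ?_⟩, f,
    fun i => (hsupp _).1 ⟨i, rfl⟩, ?_⟩
  · have h := x.total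
    rw [← hmap, Finsupp.sum_mapDomain_index (by simp) (by simp)] at h
    exact h
  · ext1
    exact hmap.symm

/-- If `p • x₀ ≤ x` pointwise with `p < 1`, then `x` is a convex combination of `x₀` and another
distribution, with weight `p` on `x₀`. -/
theorem FDist.exists_eq_convexCombPair {x₀ x : FDist S} {p q : ℝ} (hp : 0 ≤ p) (hq : 0 < q)
    (hpq : p + q = 1) (h : ∀ s, p * x₀.weights s ≤ x.weights s) :
    ∃ z : FDist S, x = convexCombPair p q hp hq.le hpq x₀ z := by
  classical
  refine ⟨⟨q⁻¹ • (x.weights - p • x₀.weights), ?_, ?_⟩, ?_⟩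
  · intro s
    have := h s
    simp only [Finsupp.coe_zero, Pi.zero_apply, Finsupp.smul_apply, Finsupp.sub_apply, smul_eq_mul]
    exact mul_nonneg (inv_nonneg.2 hq.le) (by linarith)
  · rw [Finsupp.sum_smul_index (by simp), ← Finsupp.mul_sum,
      Finsupp.sum_sub_index (by simp), Finsupp.sum_smul_index (by simp), ← Finsupp.mul_sum,
      x.total, x₀.total]
    field_simp
    linarith
  · ext1
    rw [StdSimplex.weights_convexCombPair]
    simp [smul_smul, hq.ne']

/-- A small multiple of a distribution supported in the support of `x` lies below `x`. -/
theorem FDist.exists_mul_le [Finite S] {x₀ x : FDist S}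
    (h : x₀.weights.support ⊆ x.weights.support) :
    ∃ ε > 0, ∀ p ≤ ε, ∀ s, p * x₀.weights s ≤ x.weights s := by
  have key : ∀ s, ∀ᶠ ε in nhdsWithin (0 : ℝ) (Set.Ioi 0),
      ε * x₀.weights s ≤ x.weights s := by
    intro s
    by_cases hs : x.weights s = 0
    · have : x₀.weights s = 0 := by
        by_contra h0
        exact Finsupp.mem_support_iff.1 (h (Finsupp.mem_support_iff.2 h0)) hs
      simp [hs, this]
    · have hpos : 0 < x.weights s := lt_of_le_of_ne (x.weights_nonneg s) (Ne.symm hs)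
      have ht : Filter.Tendsto (fun ε : ℝ => ε * x₀.weights s)
          (nhdsWithin (0 : ℝ) (Set.Ioi 0)) (nhds 0) := by
        have : Filter.Tendsto (fun ε : ℝ => ε * x₀.weights s) (nhds 0)
            (nhds (0 * x₀.weights s)) := (continuous_mul_const _).tendsto 0
        rw [zero_mul] at this
        exact this.mono_left nhdsWithin_le_nhds
      exact (ht.eventually_lt_const hpos).mono fun _ h => h.le
  obtain ⟨ε, hε, hε0⟩ := ((Filter.eventually_all.2 key).and self_mem_nhdsWithin).exists
  exact ⟨ε, hε0, fun p hp s =>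
    (mul_le_mul_of_nonneg_right hp (x₀.weights_nonneg s)).trans (hε s)⟩

theorem FDist.support_convexCombPair [DecidableEq S] {p q : ℝ} (hp : 0 < p) (hq : 0 < q)
    (hpq : p + q = 1) (x y : FDist S) :
    (convexCombPair p q hp.le hq.le hpq x y).weights.support =
      x.weights.support ∪ y.weights.support := by
  ext s
  rw [Finset.mem_union, Finsupp.mem_support_iff, Finsupp.mem_support_iff, Finsupp.mem_support_iff,
    FDist.weights_convexCombPair_apply]
  have hx := x.weights_nonneg s
  have hy := y.weights_nonneg s
  rw [Ne, add_eq_zero_iff_of_nonneg (mul_nonneg hp.le hx) (mul_nonneg hq.le hy),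
    mul_eq_zero_iff_left hp.ne', mul_eq_zero_iff_left hq.ne']
  tauto

end Distributions

/-! ### The belief-state transformer and convex combinations -/

namespace ProbAut

variable {S L : Type*}

theorem convStep_iff (M : ProbAut S L) (s : S) (a : L) (ξ : FDist S) :
    M.convStep s a ξ ↔
      ∃ w : FDist (FDist S), (∀ x, w.weights x ≠ 0 → M.step s a x) ∧ ξ = w.sConvexComb := by
  classical
  constructor
  · rintro ⟨n, p, ξs, h, rfl⟩
    refine ⟨p.map ξs, fun x hx => ?_, rfl⟩
    have hx' := Finsupp.mapDomain_support (Finsupp.mem_support_iff.2 hx)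
    obtain ⟨i, -, rfl⟩ := Finset.mem_image.1 hx'
    exact h i
  · rintro ⟨w, h, rfl⟩
    obtain ⟨n, p, f, hf, hw⟩ := FDist.exists_fin_map w
    exact ⟨n, p, f, fun i => h _ (hf i), by rw [hw]; rfl⟩

theorem isConvexSet_convStep (M : ProbAut S L) (s : S) (a : L) :
    IsConvexSet ℝ {ξ | M.convStep s a ξ} := by
  refine IsConvexSet.of_convexCombPair_mem fun p q hp hq hpq x hx y hy => ?_
  obtain ⟨v, hv, rfl⟩ := (M.convStep_iff s a x).1 hx
  obtain ⟨w, hw, rfl⟩ := (M.convStep_iff s a y).1 hy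
  refine (M.convStep_iff s a _).2
    ⟨convexCombPair p q hp hq hpq v w, fun x hx => ?_,
      (sConvexComb_convexCombPair p q hp hq hpq v w).symm⟩
  by_cases hvx : v.weights x = 0
  · refine hw x fun hwx => hx ?_
    rw [FDist.weights_convexCombPair_apply, hvx, hwx]
    simp
  · exact hv x hvx

/-- Steps out of `ξ` in which each state of the support of `ξ` resolves its nondeterminism by a
single convex transition, chosen by a function of the state. -/
def FunStep (M : ProbAut S L) (a : L) (ξ ζ : FDist S) : Prop :=
  ∃ f : S → FDist S, (∀ s, ξ.weights s ≠ 0 → M.convStep s a (f s)) ∧ ζ = iConvexComb ξ f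

/-- Choice functions of the two summands are averaged state by state, with the proportion in which
the two summands contribute to the state. -/
theorem FunStep.convexCombPair [Finite S] {M : ProbAut S L} {a : L} {p q : ℝ} (hp : 0 ≤ p)
    (hq : 0 ≤ q) (hpq : p + q = 1) {ξ ξ' ζ ζ' : FDist S} (h : M.FunStep a ξ ζ)
    (h' : M.FunStep a ξ' ζ') :
    M.FunStep a (Convexity.convexCombPair p q hp hq hpq ξ ξ')
      (Convexity.convexCombPair p q hp hq hpq ζ ζ') := by
  have := Fintype.ofFinite S
  obtain ⟨f, hf, rfl⟩ := h
  obtain ⟨g, hg, rfl⟩ := h'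
  have key : ∀ s, ∃ x : FDist S,
      (p * ξ.weights s + q * ξ'.weights s ≠ 0 → M.convStep s a x) ∧
      (p * ξ.weights s + q * ξ'.weights s) • x.weights =
        (p * ξ.weights s) • (f s).weights + (q * ξ'.weights s) • (g s).weights := by
    intro s
    have hu : 0 ≤ p * ξ.weights s := mul_nonneg hp (ξ.weights_nonneg s)
    have hv : 0 ≤ q * ξ'.weights s := mul_nonneg hq (ξ'.weights_nonneg s)
    rcases hu.eq_or_lt with hu0 | hu0
    · refine ⟨g s, fun hne => hg s fun h0 => hne ?_, ?_⟩
      · rw [← hu0, h0]; simp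
      · rw [← hu0]; simp
    rcases hv.eq_or_lt with hv0 | hv0
    · refine ⟨f s, fun hne => hf s fun h0 => hne ?_, ?_⟩
      · rw [← hv0, h0]; simp
      · rw [← hv0]; simp
    have hsum := add_pos hu0 hv0
    refine ⟨Convexity.convexCombPair (p * ξ.weights s / (p * ξ.weights s + q * ξ'.weights s))
      (q * ξ'.weights s / (p * ξ.weights s + q * ξ'.weights s)) (by positivity) (by positivity)
      (by field_simp) (f s) (g s), fun _ => ?_, ?_⟩
    · exact (M.isConvexSet_convStep s a).convexCombPair_mem
        (hf s (right_ne_zero_of_mul hu0.ne')) (hg s (right_ne_zero_of_mul hv0.ne')) _ _ _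
    · rw [StdSimplex.weights_convexCombPair, smul_add, smul_smul, smul_smul,
        mul_div_cancel₀ _ hsum.ne', mul_div_cancel₀ _ hsum.ne']
  choose k hk hk' using key
  refine ⟨k, fun s hs => hk s (by rwa [FDist.weights_convexCombPair_apply] at hs), ?_⟩
  ext1
  rw [StdSimplex.weights_convexCombPair]
  simp only [FDist.weights_iConvexComb_eq_sum, FDist.weights_convexCombPair_apply, hk',
    Finset.sum_add_distrib, Finset.smul_sum, smul_smul]

theorem funStep_single (M : ProbAut S L) {s : S} {a : L} {ξ : FDist S} (h : M.convStep s a ξ) :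
    M.FunStep a (StdSimplex.single s) ξ := by
  classical
  refine ⟨fun _ => ξ, fun t ht => ?_, by simp⟩
  have : s = t := by
    by_contra hst
    exact ht (by simp [hst])
  exact this ▸ h

theorem isConvexSet_funStep [Finite S] (M : ProbAut S L) (a : L) :
    IsConvexSet ℝ {x : FDist S × FDist S | M.FunStep a x.1 x.2} := by
  refine IsConvexSet.of_convexCombPair_mem fun p q hp hq hpq x hx y hy => ?_
  simpa using FunStep.convexCombPair hp hq hpq hx hy

theorem beliefStep_iff_funStep [Finite S] (M : ProbAut S L) (ξ : FDist S) (a : L) (ζ : FDist S) :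
    M.beliefStep ξ a ζ ↔ M.FunStep a ξ ζ := by
  constructor
  · rintro ⟨n, p, s, ξs, rfl, h, rfl⟩
    have := (M.isConvexSet_funStep a).iConvexComb_mem (w := p)
      (f := fun i => (StdSimplex.single (s i), ξs i)) fun i _ => M.funStep_single (h i)
    simpa [Function.comp_def] using this
  · rintro ⟨f, hf, rfl⟩
    obtain ⟨n, p, s, hs, hξ⟩ := FDist.exists_fin_map ξ
    refine ⟨n, p, s, fun i => f (s i), ?_, fun i => hf _ (hs i), ?_⟩
    · rw [hξ]
      ext1
      rw [(StdSimplex.isAffineMap_weights (R := ℝ) (I := S)).map_iConvexComb, iConvexComb_eq_sum]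
      simp [Finsupp.mapDomain]
    · rw [hξ, iConvexComb_map]

theorem beliefStep_convexCombPair [Finite S] {M : ProbAut S L} {a : L} {p q : ℝ} (hp : 0 ≤ p)
    (hq : 0 ≤ q) (hpq : p + q = 1) {ξ ξ' ζ ζ' : FDist S} (h : M.beliefStep ξ a ζ)
    (h' : M.beliefStep ξ' a ζ') :
    M.beliefStep (convexCombPair p q hp hq hpq ξ ξ') a (convexCombPair p q hp hq hpq ζ ζ') := by
  rw [beliefStep_iff_funStep] at *
  exact h.convexCombPair hp hq hpq h'

/-- Steps of a proper convex combination decompose. Positivity of both weights matters: a summand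
of weight zero need not have any step. -/
theorem exists_of_beliefStep_convexCombPair [Finite S] {M : ProbAut S L} {a : L} {p q : ℝ}
    (hp : 0 < p) (hq : 0 < q) (hpq : p + q = 1) {ξ ξ' χ : FDist S}
    (h : M.beliefStep (convexCombPair p q hp.le hq.le hpq ξ ξ') a χ) :
    ∃ ζ ζ', M.beliefStep ξ a ζ ∧ M.beliefStep ξ' a ζ' ∧
      χ = convexCombPair p q hp.le hq.le hpq ζ ζ' := by
  simp only [beliefStep_iff_funStep] at *
  obtain ⟨f, hf, rfl⟩ := h
  refine ⟨iConvexComb ξ f, iConvexComb ξ' f, ⟨f, fun s hs => hf s ?_, rfl⟩,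
    ⟨f, fun s hs => hf s ?_, rfl⟩, FDist.iConvexComb_convexCombPair_left _ _ _ _ _ _⟩
  all_goals
    rw [FDist.weights_convexCombPair_apply]
    have h1 := mul_nonneg hp.le (ξ.weights_nonneg s)
    have h2 := mul_nonneg hq.le (ξ'.weights_nonneg s)
    rw [Ne, add_eq_zero_iff_of_nonneg h1 h2]
    rintro ⟨h3, h4⟩
    simp_all [hp.ne', hq.ne']

/-! ### Distribution bisimilarity is a congruence -/

theorem bisimFun_mono (M : ProbAut S L) {R R' : Set (FDist S × FDist S)} (h : R ⊆ R') :
    M.bisimFun R ⊆ M.bisimFun R' := fun _ hζ a =>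
  ⟨fun ζ₁' h₁ => let ⟨ζ₂', h₂, hR⟩ := (hζ a).1 ζ₁' h₁; ⟨ζ₂', h₂, h hR⟩,
    fun ζ₂' h₂ => let ⟨ζ₁', h₁, hR⟩ := (hζ a).2 ζ₂' h₂; ⟨ζ₁', h₁, h hR⟩⟩

/-- Distribution bisimilarity as a set of pairs. -/
def bisimilarity (M : ProbAut S L) : Set (FDist S × FDist S) := {ζ | M.DistBisimilar ζ.1 ζ.2}

theorem isBisimulation_bisimilarity (M : ProbAut S L) : M.IsBisimulation M.bisimilarity := by
  rintro ζ ⟨R, hR, hζ⟩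
  have hsub : R ⊆ M.bisimilarity := fun ξ hξ => ⟨R, hR, hξ⟩
  exact M.bisimFun_mono hsub (hR hζ)

theorem IsBisimulation.subset_bisimilarity {M : ProbAut S L} {R : Set (FDist S × FDist S)}
    (hR : M.IsBisimulation R) : R ⊆ M.bisimilarity := fun _ hζ => ⟨R, hR, hζ⟩

theorem equivalence_bisimilarity (M : ProbAut S L) :
    Equivalence fun ζ ξ : FDist S => (ζ, ξ) ∈ M.bisimilarity := by
  have hB := M.isBisimulation_bisimilarity
  refine ⟨fun ζ => ?_, fun {ζ ξ} h => ?_, fun {ζ ξ χ} h h' => ?_⟩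
  · refine IsBisimulation.subset_bisimilarity (R := {x | x.1 = x.2}) ?_
      (rfl : ζ = ζ)
    rintro ⟨x, y⟩ hxy a
    obtain rfl : x = y := hxy
    exact ⟨fun x' hx => ⟨x', hx, rfl⟩, fun x' hx => ⟨x', hx, rfl⟩⟩
  · refine IsBisimulation.subset_bisimilarity (R := {x | (x.2, x.1) ∈ M.bisimilarity}) ?_ h
    intro x hx a
    exact ⟨(hB hx a).2, (hB hx a).1⟩
  · refine IsBisimulation.subset_bisimilarity
      (R := {x | ∃ y, (x.1, y) ∈ M.bisimilarity ∧ (y, x.2) ∈ M.bisimilarity}) ?_ ⟨ξ, h, h'⟩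
    rintro ⟨x, z⟩ ⟨y, hxy, hyz⟩ a
    constructor
    · intro x' hx
      obtain ⟨y', hy, hxy'⟩ := (hB hxy a).1 x' hx
      obtain ⟨z', hz, hyz'⟩ := (hB hyz a).1 y' hy
      exact ⟨z', hz, y', hxy', hyz'⟩
    · intro z' hz
      obtain ⟨y', hy, hyz'⟩ := (hB hyz a).2 z' hz
      obtain ⟨x', hx, hxy'⟩ := (hB hxy a).2 y' hy
      exact ⟨x', hx, y', hxy', hyz'⟩

theorem isConvexCongruence_bisimilarity [Finite S] (M : ProbAut S L) :
    IsConvexCongruence M.bisimilarity := by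
  have hB := M.isBisimulation_bisimilarity
  refine ⟨M.equivalence_bisimilarity, fun p q hp hq hpq ζ₁ ζ₂ ξ₁ ξ₂ hζ hξ => ?_⟩
  -- Degenerate weights are set aside, since there steps of the combination do not decompose.
  rcases hp.eq_or_lt with rfl | hp
  · obtain rfl : q = 1 := by linarith
    simpa using hξ
  rcases hq.eq_or_lt with rfl | hq
  · obtain rfl : p = 1 := by linarith
    simpa using hζ
  refine IsBisimulation.subset_bisimilarity (R := {x | ∃ ζ₁ ζ₂ ξ₁ ξ₂,
    (ζ₁, ζ₂) ∈ M.bisimilarity ∧ (ξ₁, ξ₂) ∈ M.bisimilarity ∧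
    x = (convexCombPair p q hp.le hq.le hpq ζ₁ ξ₁, convexCombPair p q hp.le hq.le hpq ζ₂ ξ₂)}) ?_
    ⟨ζ₁, ζ₂, ξ₁, ξ₂, hζ, hξ, rfl⟩
  rintro _ ⟨ζ₁, ζ₂, ξ₁, ξ₂, hζ, hξ, rfl⟩ a
  constructor
  · intro χ hχ
    obtain ⟨ζ₁', ξ₁', h₁, h₂, rfl⟩ := exists_of_beliefStep_convexCombPair hp hq hpq hχ
    obtain ⟨ζ₂', h₁', hζ'⟩ := (hB hζ a).1 _ h₁
    obtain ⟨ξ₂', h₂', hξ'⟩ := (hB hξ a).1 _ h₂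
    exact ⟨_, beliefStep_convexCombPair _ _ _ h₁' h₂', ζ₁', ζ₂', ξ₁', ξ₂', hζ', hξ', rfl⟩
  · intro χ hχ
    obtain ⟨ζ₂', ξ₂', h₁, h₂, rfl⟩ := exists_of_beliefStep_convexCombPair hp hq hpq hχ
    obtain ⟨ζ₁', h₁', hζ'⟩ := (hB hζ a).2 _ h₁
    obtain ⟨ξ₁', h₂', hξ'⟩ := (hB hξ a).2 _ h₂
    exact ⟨_, beliefStep_convexCombPair _ _ _ h₁' h₂', ζ₁', ζ₂', ξ₁', ξ₂', hζ', hξ', rfl⟩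

end ProbAut

/-! ### A congruence on the relative interior of a face -/

namespace IsConvexCongruence

variable {S : Type*} {C C' : Set (FDist S × FDist S)}

/-- Pairs of `C` can be transported by a translation with a small multiple of their difference: if
`p • x₀ ≤ x`, then `x = p • x₀ + q • z` is related to `p • y₀ + q • z`. -/
theorem mem_of_sub_eq_smul (hC : IsConvexCongruence C) {x₀ y₀ x y : FDist S}
    (h₀ : (x₀, y₀) ∈ C) {p : ℝ} (hp : 0 ≤ p) (hp1 : p < 1)
    (hx : ∀ s, p * x₀.weights s ≤ x.weights s)
    (h : y.weights - x.weights = p • (y₀.weights - x₀.weights)) : (x, y) ∈ C := by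
  obtain ⟨z, rfl⟩ := FDist.exists_eq_convexCombPair hp (sub_pos.2 hp1) (by ring) hx
  have hy : y = convexCombPair p (1 - p) hp (sub_pos.2 hp1).le (by ring) y₀ z := by
    ext1
    rw [StdSimplex.weights_convexCombPair] at h ⊢
    rw [sub_eq_iff_eq_add.1 h, smul_sub]
    abel
  rw [hy]
  exact hC.convexComb _ _ _ _ _ _ _ _ _ h₀ (hC.equivalence.refl z)

/-- Larger translations are composed of small ones: a segment along which the multiple `m • x₀`
stays below all points is bisected until the halves are covered by `mem_of_sub_eq_smul`. -/
theorem mem_of_sub_eq_smul_of_le_pow (hC : IsConvexCongruence C) {x₀ y₀ : FDist S}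
    (h₀ : (x₀, y₀) ∈ C) {m : ℝ} (hm1 : m < 1) (n : ℕ) :
    ∀ {x y : FDist S} {t : ℝ}, 0 ≤ t → t ≤ 2 ^ n * m →
      (∀ s, m * x₀.weights s ≤ x.weights s) → (∀ s, m * x₀.weights s ≤ y.weights s) →
      y.weights - x.weights = t • (y₀.weights - x₀.weights) → (x, y) ∈ C := by
  induction n with
  | zero =>
    intro x y t ht htm hx _ h
    have htm' : t ≤ m := by simpa using htm
    exact hC.mem_of_sub_eq_smul h₀ ht (htm'.trans_lt hm1)
      (fun s => (mul_le_mul_of_nonneg_right htm' (x₀.weights_nonneg s)).trans (hx s)) h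
  | succ n ih =>
    intro x y t ht htm hx hy h
    let z : FDist S := convexCombPair (1 / 2 : ℝ) (1 / 2) (by norm_num) (by norm_num)
      (by norm_num) x y
    have hzw : z.weights = (1 / 2 : ℝ) • x.weights + (1 / 2 : ℝ) • y.weights :=
      StdSimplex.weights_convexCombPair ..
    have hz : ∀ s, m * x₀.weights s ≤ z.weights s := by
      intro s
      rw [FDist.weights_convexCombPair_apply]
      linarith [hx s, hy s]
    have ht2 : t / 2 ≤ 2 ^ n * m := by
      rw [pow_succ] at htm
      linarith
    have hhalf : (t / 2) • (y₀.weights - x₀.weights) =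
        (1 / 2 : ℝ) • (y.weights - x.weights) := by
      rw [h, smul_smul]
      congr 1
      ring
    refine hC.equivalence.trans (ih (by positivity) ht2 hx hz ?_)
      (ih (by positivity) ht2 hz hy ?_)
    · rw [hhalf, hzw]
      module
    · rw [hhalf, hzw]
      module

theorem mem_of_sub_eq_smul_of_support [Finite S] (hC : IsConvexCongruence C)
    {x₀ y₀ x y : FDist S} (h₀ : (x₀, y₀) ∈ C)
    (hx : x₀.weights.support ⊆ x.weights.support) (hy : x₀.weights.support ⊆ y.weights.support)
    {t : ℝ} (ht : 0 ≤ t) (h : y.weights - x.weights = t • (y₀.weights - x₀.weights)) :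
    (x, y) ∈ C := by
  obtain ⟨ε, hε, hεx⟩ := FDist.exists_mul_le hx
  obtain ⟨δ, hδ, hδy⟩ := FDist.exists_mul_le hy
  obtain ⟨m, hm, hmε⟩ := exists_between (lt_min (lt_min hε hδ) one_pos)
  obtain ⟨n, hn⟩ := pow_unbounded_of_one_lt (t / m) one_lt_two
  exact hC.mem_of_sub_eq_smul_of_le_pow h₀ (hmε.trans_le (min_le_right _ _)) n ht
    ((div_le_iff₀ hm).1 hn.le)
    (hεx m (hmε.le.trans ((min_le_left _ _).trans (min_le_left _ _))))
    (hδy m (hmε.le.trans ((min_le_left _ _).trans (min_le_right _ _)))) h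

/-- The directions `t • (y - x)`, `0 ≤ t`, in which a congruence `C` relates distributions `x`, `y`
supported in `T`. They form a subspace: sums come from convex combinations of pairs and negatives
from symmetry. A point `e` of the face is needed for the zero vector. -/
def directions (hC : IsConvexCongruence C) (T : Finset S) (e : FDist S)
    (he : e.weights.support ⊆ T) : Submodule ℝ (S →₀ ℝ) where
  carrier := {v | ∃ x y : FDist S, x.weights.support ⊆ T ∧ y.weights.support ⊆ T ∧ (x, y) ∈ C ∧
    ∃ t : ℝ, 0 ≤ t ∧ v = t • (y.weights - x.weights)}
  zero_mem' := ⟨e, e, he, he, hC.equivalence.refl e, 0, le_rfl, by simp⟩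
  add_mem' := by
    classical
    rintro _ _ ⟨x, y, hx, hy, hxy, t, ht, rfl⟩ ⟨x', y', hx', hy', hxy', u, hu, rfl⟩
    rcases ht.eq_or_lt with rfl | ht
    · exact ⟨x', y', hx', hy', hxy', u, hu, by simp⟩
    rcases hu.eq_or_lt with rfl | hu
    · exact ⟨x, y, hx, hy, hxy, t, ht.le, by simp⟩
    have htu : t / (t + u) + u / (t + u) = 1 := by field_simp
    have htp : 0 < t / (t + u) := by positivity
    have hup : 0 < u / (t + u) := by positivity
    refine ⟨convexCombPair _ _ htp.le hup.le htu x x', convexCombPair _ _ htp.le hup.le htu y y',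
      ?_, ?_, hC.convexComb _ _ _ _ _ _ _ _ _ hxy hxy', t + u, by positivity, ?_⟩
    · rw [FDist.support_convexCombPair htp hup]
      exact Finset.union_subset hx hx'
    · rw [FDist.support_convexCombPair htp hup]
      exact Finset.union_subset hy hy'
    · have h1 : t = (t + u) * (t / (t + u)) := by field_simp
      have h2 : u = (t + u) * (u / (t + u)) := by field_simp
      rw [StdSimplex.weights_convexCombPair, StdSimplex.weights_convexCombPair]
      generalize t / (t + u) = c at *
      generalize u / (t + u) = d at *
      generalize t + u = r at *
      subst h1 h2
      module
  smul_mem' := by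
    rintro c _ ⟨x, y, hx, hy, hxy, t, ht, rfl⟩
    rcases le_total 0 c with hc | hc
    · exact ⟨x, y, hx, hy, hxy, c * t, mul_nonneg hc ht, by rw [smul_smul]⟩
    · refine ⟨y, x, hy, hx, hC.equivalence.symm hxy, -c * t,
        mul_nonneg (neg_nonneg.2 hc) ht, ?_⟩
      module

/-- On the relative interior of a face, a congruence is determined by its directions. -/
theorem mem_of_sub_mem_directions [Finite S] (hC : IsConvexCongruence C) {T : Finset S}
    {e : FDist S} {he : e.weights.support ⊆ T} {x y : FDist S} (hx : x.weights.support = T)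
    (hy : y.weights.support = T) (h : y.weights - x.weights ∈ hC.directions T e he) :
    (x, y) ∈ C := by
  obtain ⟨x₀, y₀, hx₀, -, h₀, t, ht, hxy⟩ := h
  exact hC.mem_of_sub_eq_smul_of_support h₀ (hx ▸ hx₀) (hy ▸ hx₀) ht hxy

/-! ### Congruences are finitely generated -/

/-- The restriction of a congruence to the relative interior of a face is finitely generated. -/
theorem exists_finite_generating_interior [Finite S] (C : Set (FDist S × FDist S))
    (T : Finset S) :
    ∃ R ⊆ C, R.Finite ∧ ∀ C', IsConvexCongruence C' → R ⊆ C' →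
      ∀ x y : FDist S, x.weights.support = T → y.weights.support = T → (x, y) ∈ C →
        (x, y) ∈ C' := by
  classical
  let P : Set (FDist S × FDist S) :=
    {x | x ∈ C ∧ x.1.weights.support ⊆ T ∧ x.2.weights.support ⊆ T}
  let d : FDist S × FDist S → S →₀ ℝ := fun x => x.2.weights - x.1.weights
  obtain ⟨D, hDP, hD⟩ := (Submodule.fg_span_iff_fg_span_finset_subset (R := ℝ) (d '' P)).1
    (IsNoetherian.noetherian _)
  obtain ⟨R, hRP, hRfin, hRD⟩ := (Set.exists_subset_image_finite_and
      (p := fun t => Submodule.span ℝ (d '' P) = Submodule.span ℝ t)).1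
    ⟨(D : Set (S →₀ ℝ)), hDP, D.finite_toSet, hD⟩
  refine ⟨R, fun x hx => (hRP hx).1, hRfin, fun C' hC' hRC' x y hx hy hxy => ?_⟩
  refine hC'.mem_of_sub_mem_directions (e := x) (he := hx.subset) hx hy ?_
  have hle : Submodule.span ℝ (d '' R) ≤ hC'.directions T x hx.subset := by
    rw [Submodule.span_le]
    rintro _ ⟨⟨x', y'⟩, hr, rfl⟩
    exact ⟨x', y', (hRP hr).2.1, (hRP hr).2.2, hRC' hr, 1, zero_le_one, (one_smul _ _).symm⟩
  exact hle (hRD ▸ Submodule.subset_span ⟨(x, y), ⟨hxy, hx.subset, hy.subset⟩, rfl⟩)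

/-- One pair of `C` with supports `T ⊆ U` suffices to relate every point with support `T` that is
related by `C` to some point with support `U` to such a point. -/
theorem exists_finite_generating_between [Finite S] {C : Set (FDist S × FDist S)}
    (hC : IsConvexCongruence C) (T U : Finset S) (hTU : T ⊆ U) :
    ∃ R ⊆ C, R.Finite ∧ ∀ C', IsConvexCongruence C' → R ⊆ C' →
      ∀ x y : FDist S, x.weights.support = T → y.weights.support = U → (x, y) ∈ C →
        ∃ y' : FDist S, y'.weights.support = U ∧ (x, y') ∈ C ∧ (x, y') ∈ C' := by
  classical
  by_cases hne : ∃ x₀ y₀ : FDist S, x₀.weights.support = T ∧ y₀.weights.support = U ∧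
      (x₀, y₀) ∈ C
  · obtain ⟨x₀, y₀, hx₀, hy₀, h₀⟩ := hne
    refine ⟨{(x₀, y₀)}, by simpa using h₀, Set.finite_singleton _, ?_⟩
    intro C' hC' hR x y hx hy _
    obtain ⟨ε, hε, hεx⟩ := FDist.exists_mul_le (x₀ := x₀) (x := x) (by rw [hx, hx₀])
    obtain ⟨p, hp, hpε⟩ := exists_between (lt_min hε one_pos)
    have hq : 0 < 1 - p := sub_pos.2 (hpε.trans_le (min_le_right _ _))
    obtain ⟨z, rfl⟩ := FDist.exists_eq_convexCombPair hp.le hq (by ring)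
      (hεx p (hpε.le.trans (min_le_left _ _)))
    rw [FDist.support_convexCombPair hp hq] at hx
    refine ⟨convexCombPair p (1 - p) hp.le hq.le (by ring) y₀ z, ?_,
      hC.convexComb _ _ _ _ _ _ _ _ _ h₀ (hC.equivalence.refl z),
      hC'.convexComb _ _ _ _ _ _ _ _ _ (hR rfl) (hC'.equivalence.refl z)⟩
    rw [FDist.support_convexCombPair hp hq, hy₀]
    exact Finset.union_eq_left.2 ((Finset.subset_union_right.trans hx.subset).trans hTU)
  · exact ⟨∅, Set.empty_subset _, Set.finite_empty, fun C' _ _ x y hx hy h =>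
      (hne ⟨x, y, hx, hy, h⟩).elim⟩

/-- Every congruence of the convex algebra of distributions on a finite set is finitely
generated. -/
theorem exists_finite_generating [Finite S] {C : Set (FDist S × FDist S)}
    (hC : IsConvexCongruence C) : ∃ R ⊆ C, R.Finite ∧ C ⊆ cgr R := by
  classical
  choose A hAC hAfin hA using exists_finite_generating_interior C
  choose B hBC hBfin hB using hC.exists_finite_generating_between
  refine ⟨(⋃ T, A T) ∪ ⋃ T, ⋃ U, ⋃ h, B T U h, ?_, ?_, ?_⟩
  · simp only [Set.union_subset_iff, Set.iUnion_subset_iff]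
    exact ⟨hAC, hBC⟩
  · exact (Set.finite_iUnion hAfin).union
      (Set.finite_iUnion fun T => Set.finite_iUnion fun U => Set.finite_iUnion fun h =>
        hBfin T U h)
  rintro ⟨x, y⟩ hxy C' ⟨hC', hR⟩
  simp only [Set.union_subset_iff, Set.iUnion_subset_iff] at hR
  -- Pairs whose supports are nested: move `x` into the face of `y`, then compare there.
  have nested : ∀ x y : FDist S, x.weights.support ⊆ y.weights.support → (x, y) ∈ C →
      (x, y) ∈ C' := by
    intro x y hsub hxy
    obtain ⟨y', hy', hxy', hxy''⟩ := hB _ _ hsub C' hC' (hR.2 _ _ hsub) x y rfl rfl hxy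
    exact hC'.equivalence.trans hxy'' (hA _ C' hC' (hR.1 _) y' y hy' rfl
      (hC.equivalence.trans (hC.equivalence.symm hxy') hxy))
  -- In general, `x` and `y` are both compared with their midpoint `z`.
  have hhalf : (0 : ℝ) < 1 / 2 := by norm_num
  let z : FDist S := convexCombPair (1 / 2 : ℝ) (1 / 2) hhalf.le hhalf.le (by norm_num) x y
  have hz : z.weights.support = x.weights.support ∪ y.weights.support :=
    FDist.support_convexCombPair hhalf hhalf (by norm_num) x y
  have hxz : (x, z) ∈ C := by
    have := hC.convexComb (1 / 2) (1 / 2) hhalf.le hhalf.le (by norm_num) x x x y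
      (hC.equivalence.refl x) hxy
    rwa [convexCombPair_same] at this
  have hyz : (y, z) ∈ C := hC.equivalence.trans (hC.equivalence.symm hxy) hxz
  exact hC'.equivalence.trans (nested x z (hz ▸ Finset.subset_union_left) hxz)
    (hC'.equivalence.symm (nested y z (hz ▸ Finset.subset_union_right) hyz))

end IsConvexCongruence

theorem mainTheorem2 {S : Type*} [Finite S] {L : Type*} (M : ProbAut S L)
    (ζ₁ ζ₂ : FDist S) (h : M.DistBisimilar ζ₁ ζ₂) :
    ∃ R : Set (FDist S × FDist S),
      R.Finite ∧ M.IsBisimulationUpTo cgr R ∧ (ζ₁, ζ₂) ∈ R := by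
  obtain ⟨R, hR, hfin, hgen⟩ := M.isConvexCongruence_bisimilarity.exists_finite_generating
  refine ⟨insert (ζ₁, ζ₂) R, hfin.insert _, ?_, Set.mem_insert _ _⟩
  have hsub : insert (ζ₁, ζ₂) R ⊆ M.bisimilarity := Set.insert_subset h hR
  have hcgr : M.bisimilarity ⊆ cgr (insert (ζ₁, ζ₂) R) := hgen.trans
    (Set.sInter_subset_sInter fun C hC => ⟨hC.1, (Set.subset_insert _ _).trans hC.2⟩)
  exact hsub.trans (M.isBisimulation_bisimilarity.trans (M.bisimFun_mono hcgr))
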